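/- Let $N\ge 0$ and, for $h=1,\dots,N$, let $\mu_h,\beta_h\in\mathbb R$, $a_h\ge 0$, $\alpha_h\in(0,2]\setminus\{1\}$, $\lambda_{+,h},\lambda_{-,h}>0$. For $\alpha\in(0,2)$ and $\lambda_+,\lambda_->0$, the standardized classical tempered stable law $\mathrm{stdCTS}(\alpha,\lambda_+,\lambda_-)$ is the centred infinitely divisible law on $\mathbb R$ without Gaussian part whose Lévy measure has density $$C\Big(\frac{e^{-\lambda_+x}}{x^{1+\alpha}}\mathbf 1_{x>0}+\frac{e^{-\lambda_-|x|}}{|x|^{1+\alpha}}\mathbf 1_{x<0}\Big),\qquad C=\frac1{\Gamma(2-\alpha)\,(\lambda_+^{\alpha-2}+\lambda_-^{\alpha-2})},$$ that is, its characteristic function is $u\mapsto\exp\int(e^{iux}-1-iux)\,\nu(dx)$, where $\nu$ is this Lévy measure. For $\alpha=2$ it is the standard normal law. On a probability space let $G_1,\dots,G_N,Z$ be mutually independent, infinitely divisible random variables with values in $[0,\infty)$, and put $V_h=G_h+a_hZ$. Let $X_1,\dots,X_N$ be real random variables that are conditionally independent given $\chi=\sigma(G_1,\dots,G_N,Z)$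 and such that, for each $h$, almost surely on $\{V_h>0\}$ the conditional law of $X_h$ given $\chi$ is $\mathrm{stdCTS}(\alpha_h,\lambda_{+,h}\sqrt{V_h},\lambda_{-,h}\sqrt{V_h})$. The multivariate MixedTS vector $Y=(Y_1,\dots,Y_N)$ is given by $$Y_h=\mu_h+\beta_hV_h+\sqrt{V_h}\,X_h .$$ For a random variable $W$ write $\Phi_W(z)=\log E[e^{zW}]$ for $z\in\mathbb C$ (where $E[e^{zW}]$ exists and is nonzero; the choice of the branch does not matter below), and let, with principal values of the powers, $$L_{stdCTS}(u;\lambda_+,\lambda_-,\alpha)=\frac{(\lambda_+-iu)^{\alpha}-\lambda_+^{\alpha}+(\lambda_-+iu)^{\alpha}-\lambda_-^{\alpha}}{\alpha(\alpha-1)(\lambda_+^{\alpha-2}+\lambda_-^{\alpha-2})}+\frac{iu(\lambda_+^{\alpha-1}-\lambda_-^{\alpha-1})}{(\alpha-1)(\lambda_+^{\alpha-2}+\lambda_-^{\alpha-2})}.$$ Then $L_{stdCTS}$ is the characteristic exponent of the standardized CTS law: for each $h$, $\mathrm{stdCTS}(\alpha_h,\lambda_{+,h},\lambda_{-,h})$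 has characteristic function $t\mapsto\exp L_{stdCTS}(t;\lambda_{+,h},\lambda_{-,h},\alpha_h)$. Moreover, for every $u\in\mathbb R^N$, with $L_h=L_{stdCTS}(u_h;\lambda_{+,h},\lambda_{-,h},\alpha_h)$, $$E\big[e^{i\langle u,Y\rangle}\big]=e^{i\sum_{h=1}^Nu_h\mu_h}\;e^{\Phi_Z\left(\sum_{h=1}^N(i\,a_hu_h\beta_h+a_hL_h)\right)}\;\prod_{h=1}^Ne^{\Phi_{G_h}\left(i\,u_h\beta_h+L_h\right)},$$ where the expectations $E[e^{zZ}]$ and $E[e^{zG_h}]$ that define $\Phi_Z$ and $\Phi_{G_h}$ exist and are nonzero at the points $z$ at which they are evaluated. -/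

import Mathlib

open MeasureTheory ProbabilityTheory

/-- A law on `ℝ` is infinitely divisible: for every `n ≥ 1` it is the law of a sum of `n`
independent copies of some random variable. -/
def IsInfinitelyDivisible (ρ : Measure ℝ) : Prop :=
  ∀ n : ℕ, 1 ≤ n → ∃ ν : Measure ℝ, IsProbabilityMeasure ν ∧
    ρ = (Measure.pi (fun _ : Fin n => ν)).map (fun x => ∑ i, x i)

/-- The normalising constant `1 / (Γ(2 - α) (λ₊ ^ (α - 2) + λ₋ ^ (α - 2)))`, for which the law with
the Lévy density below has unit variance. -/
noncomputable def stdCTSConst (α lp lm : ℝ) : ℝ :=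
  1 / (Real.Gamma (2 - α) * (lp ^ (α - 2) + lm ^ (α - 2)))

/-- The Lévy density of the standardized classical tempered stable law (`0 < α < 2`). -/
noncomputable def stdCTSLevyDensity (α lp lm x : ℝ) : ℝ :=
  if 0 < x then stdCTSConst α lp lm * Real.exp (-lp * x) / x ^ (1 + α)
  else if x < 0 then stdCTSConst α lp lm * Real.exp (-lm * |x|) / |x| ^ (1 + α)
  else 0

/-- The Lévy measure of the standardized classical tempered stable law (`0 < α < 2`). -/
noncomputable def stdCTSLevyMeasure (α lp lm : ℝ) : Measure ℝ :=
  volume.withDensity (fun x => ENNReal.ofReal (stdCTSLevyDensity α lp lm x))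

/-- `ρ` is the standardized classical tempered stable law `stdCTS(α, λ₊, λ₋)`, for `0 < α ≤ 2` and
`λ₊, λ₋ > 0`. For `α < 2` it is the centred, purely non-Gaussian infinitely divisible law with the
Lévy measure above (Lévy-Khintchine formula with compensator `x`); for `α = 2` it is the standard
normal law. -/
def IsStdCTS (α lp lm : ℝ) (ρ : Measure ℝ) : Prop :=
  IsProbabilityMeasure ρ ∧
  (α < 2 → ∀ u : ℝ, charFun ρ u =
    Complex.exp (∫ x, (Complex.exp (Complex.I * u * x) - 1 - Complex.I * u * x)
      ∂(stdCTSLevyMeasure α lp lm))) ∧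
  (α = 2 → ρ = gaussianReal 0 1)

/-- The closed-form exponent `L_stdCTS(u; λ₊, λ₋, α)` (complex powers are principal values). -/
noncomputable def stdCTSExponent (u lp lm α : ℝ) : ℂ :=
  ((lp - Complex.I * u : ℂ) ^ (α : ℂ) - (lp : ℂ) ^ (α : ℂ)
      + (lm + Complex.I * u : ℂ) ^ (α : ℂ) - (lm : ℂ) ^ (α : ℂ))
    / (α * (α - 1) * ((lp : ℂ) ^ ((α : ℂ) - 2) + (lm : ℂ) ^ ((α : ℂ) - 2)))
  + Complex.I * u * ((lp : ℂ) ^ ((α : ℂ) - 1) - (lm : ℂ) ^ ((α : ℂ) - 1))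
    / ((α - 1) * ((lp : ℂ) ^ ((α : ℂ) - 2) + (lm : ℂ) ^ ((α : ℂ) - 2)))

/-- `Φ_V(z) = log E[exp(z V)]` at a complex argument `z`. -/
noncomputable def logMGF {Ω : Type*} [MeasurableSpace Ω] (P : Measure Ω) (V : Ω → ℝ) (z : ℂ) : ℂ :=
  Complex.log (complexMGF V P z)

/-- `Y` is a multivariate MixedTS random vector with parameters `μ, β, a, α, λ₊, λ₋`, built from the
non-negative infinitely divisible variables `G₁, …, G_N, Z` and the variables `X₁, …, X_N`. -/
structure IsMultivariateMixedTS {Ω : Type*} [MeasurableSpace Ω] (P : Measure Ω)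
    [IsProbabilityMeasure P] {N : ℕ} (μ β a α lp lm : Fin N → ℝ)
    (G : Fin N → Ω → ℝ) (Z : Ω → ℝ) (X : Fin N → Ω → ℝ)
    (Y : Ω → EuclideanSpace ℝ (Fin N)) : Prop where
  a_nonneg : ∀ i, 0 ≤ a i
  alpha_pos : ∀ i, 0 < α i
  alpha_le_two : ∀ i, α i ≤ 2
  lp_pos : ∀ i, 0 < lp i
  lm_pos : ∀ i, 0 < lm i
  measurable_G : ∀ i, Measurable (G i)
  measurable_Z : Measurable Z
  measurable_X : ∀ i, Measurable (X i)
  G_nonneg : ∀ i, ∀ᵐ ω ∂P, 0 ≤ G i ω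
  Z_nonneg : ∀ᵐ ω ∂P, 0 ≤ Z ω
  G_infDiv : ∀ i, IsInfinitelyDivisible (P.map (G i))
  Z_infDiv : IsInfinitelyDivisible (P.map Z)
  /-- `G₁, …, G_N, Z` are mutually independent. -/
  indep : iIndepFun (fun j : Option (Fin N) => j.elim Z G) P
  /-- Given `χ = σ(G₁, …, G_N, Z)`, the variables `X₁, …, X_N` are independent. -/
  cond_indep : ∀ᵐ ω ∂P, iIndepFun (fun (i : Fin N) (x : Fin N → ℝ) => x i)
    (condDistrib (fun ω i => X i ω) (fun ω => ((fun i => G i ω), Z ω)) P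
      ((fun i => G i ω), Z ω))
  /-- Given `χ`, the law of `X i` is `stdCTS(α i, λ₊ i √(V i), λ₋ i √(V i))`, where
  `V i = G i + a i Z`. Nothing is required where `V i = 0`, since `X i` does not enter `Y` there. -/
  cond_law : ∀ i, ∀ᵐ ω ∂P, 0 < G i ω + a i * Z ω →
    IsStdCTS (α i) (lp i * √(G i ω + a i * Z ω)) (lm i * √(G i ω + a i * Z ω))
      ((condDistrib (fun ω i => X i ω) (fun ω => ((fun i => G i ω), Z ω)) P
        ((fun i => G i ω), Z ω)).map (fun x => x i))
  Y_eq : ∀ᵐ ω ∂P, ∀ i, Y ω i =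
    μ i + β i * (G i ω + a i * Z ω) + √(G i ω + a i * Z ω) * X i ω

/-!
Conditionally on `G₁, …, G_N, Z`, the vector `Y` is affine in independent standardized CTS
variables. The scaling `L(r u; r λ₊, r λ₋, α) = r² L(u; λ₊, λ₋, α)` with `r = √V` turns the
conditional characteristic function into the exponential of a linear function of the `V i`, hence of
`G₁, …, G_N, Z`, and the independence of these variables factorizes its expectation.

The exponent `L` is computed by writing `exp y - 1 - y` as a second-order Taylor integral: after
Fubini the Lévy integral becomes a Gamma integral with complex rate, known by analytic continuation
from real rates.

If `V ≥ 0` is infinitely divisible and `Re z ≤ 0`, then `E exp (z V) = (E exp (z Vₙ)) ^ n` with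
`|1 - E exp (z Vₙ)| ≤ (2 + |z|) (1 - (E exp (-V)) ^ (1 / n))`, which is less than `1` for large `n`;
so `E exp (z V)` does not vanish.
-/

section TemperedStableIntegral

open Complex Set Filter Topology

theorem eqOn_of_frequently_eq_ofReal {E : Type*} [NormedAddCommGroup E] [NormedSpace ℂ E]
    {f g : ℂ → E} {U : Set ℂ} (hf : AnalyticOnNhd ℂ f U) (hg : AnalyticOnNhd ℂ g U)
    (hU : IsPreconnected U) {x : ℝ} (hx : (x : ℂ) ∈ U) (hfg : ∃ᶠ r : ℝ in 𝓝[≠] x, f r = g r) :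
    EqOn f g U := by
  have hx_tendsto : Tendsto ((↑) : ℝ → ℂ) (𝓝[≠] x) (𝓝[≠] (x : ℂ)) :=
    tendsto_nhdsWithin_iff.2 ⟨(continuous_ofReal.tendsto x).mono_left nhdsWithin_le_nhds,
      eventually_mem_nhdsWithin.mono fun r hr => by simpa using hr⟩
  exact hf.eqOn_of_preconnected_of_frequently_eq hg hU hx (hx_tendsto.frequently hfg)

theorem integrableOn_rpow_mul_exp_neg_mul {s r : ℝ} (hs : 0 < s) (hr : 0 < r) :
    IntegrableOn (fun x : ℝ => x ^ (s - 1) * Real.exp (-r * x)) (Ioi 0) := by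
  simpa using integrableOn_rpow_mul_exp_neg_mul_rpow (s := s - 1) (by linarith) one_pos hr

theorem integral_rpow_mul_cexp_neg_ofReal_mul_Ioi {s r : ℝ} (hs : 0 < s) (hr : 0 < r) :
    ∫ x in Ioi (0 : ℝ), ((x ^ (s - 1) : ℝ) : ℂ) * exp (-r * x)
      = Real.Gamma s * (r : ℂ) ^ (-s : ℂ) := by
  have hr_arg : (r : ℂ).arg ≠ Real.pi := by
    rw [arg_ofReal_of_nonneg hr.le]
    exact Real.pi_pos.ne
  have hGamma := integral_cpow_mul_exp_neg_mul_Ioi (a := s) (r := r) (by simpa) hr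
  rw [Gamma_ofReal, one_div, inv_cpow _ _ hr_arg, ← cpow_neg, mul_comm] at hGamma
  rw [← hGamma]
  refine setIntegral_congr_fun measurableSet_Ioi fun x hx => ?_
  rw [ofReal_cpow (le_of_lt hx), neg_mul]
  push_cast
  rfl

theorem analyticOnNhd_integral_rpow_mul_cexp_neg_mul {s : ℝ} (hs : 0 < s) :
    AnalyticOnNhd ℂ (fun z => ∫ x in Ioi (0 : ℝ), ((x ^ (s - 1) : ℝ) : ℂ) * exp (-z * x))
      {z | 0 < z.re} := by
  set m : Measure ℝ := (volume.restrict (Ioi (0 : ℝ))).withDensity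
    (fun x => ENNReal.ofReal (x ^ (s - 1))) with hm
  have hdensity : Measurable fun x : ℝ => ENNReal.ofReal (x ^ (s - 1)) := by fun_prop
  have hmgf : (fun z => ∫ x in Ioi (0 : ℝ), ((x ^ (s - 1) : ℝ) : ℂ) * exp (-z * x))
      = complexMGF id m ∘ Neg.neg := by
    ext z
    rw [Function.comp_apply, complexMGF, hm,
      integral_withDensity_eq_integral_toReal_smul hdensity (by simp)]
    refine setIntegral_congr_fun measurableSet_Ioi fun x hx => ?_
    simp [ENNReal.toReal_ofReal (Real.rpow_nonneg (le_of_lt hx) _)]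
  have hIio : Iio (0 : ℝ) ⊆ integrableExpSet id m := by
    intro t ht
    rw [integrableExpSet, mem_ofPred_eq, hm,
      integrable_withDensity_iff_integrable_smul' hdensity (by simp)]
    refine (integrableOn_rpow_mul_exp_neg_mul hs (neg_pos.2 ht)).congr_fun
      (fun x hx => ?_) measurableSet_Ioi
    simp [ENNReal.toReal_ofReal (Real.rpow_nonneg (le_of_lt hx) _)]
  rw [hmgf]
  intro z hz
  refine (analyticAt_complexMGF (interior_mono hIio ?_)).comp analyticAt_id.neg
  simpa [isOpen_Iio.interior_eq] using hz

theorem integral_rpow_mul_cexp_neg_mul_Ioi {s : ℝ} (hs : 0 < s) {z : ℂ} (hz : 0 < z.re) :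
    ∫ x in Ioi (0 : ℝ), ((x ^ (s - 1) : ℝ) : ℂ) * exp (-z * x)
      = Real.Gamma s * z ^ (-s : ℂ) := by
  have hpow : AnalyticOnNhd ℂ (fun w : ℂ => Real.Gamma s * w ^ (-s : ℂ)) {w | 0 < w.re} :=
    fun w hw => analyticAt_const.mul (analyticAt_id.cpow analyticAt_const (Or.inl hw))
  have hreal : ∀ᶠ r : ℝ in 𝓝[≠] 1,
      ∫ x in Ioi (0 : ℝ), ((x ^ (s - 1) : ℝ) : ℂ) * exp (-r * x)
        = Real.Gamma s * (r : ℂ) ^ (-s : ℂ) :=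
    nhdsWithin_le_nhds ((lt_mem_nhds one_pos).mono fun _ hr =>
      integral_rpow_mul_cexp_neg_ofReal_mul_Ioi hs hr)
  exact eqOn_of_frequently_eq_ofReal (analyticOnNhd_integral_rpow_mul_cexp_neg_mul hs) hpow
    (convex_halfSpace_re_gt 0).isPreconnected (x := 1) (by simp) hreal.frequently hz

theorem map_add_sub_sub_eq_integral {E : Type*} [NormedAddCommGroup E] [NormedSpace ℂ E]
    [CompleteSpace E] {f f' f'' : ℂ → E} {z w : ℂ}
    (hf : ∀ t ∈ Icc (0 : ℝ) 1, HasDerivAt f (f' (z + t * w)) (z + t * w))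
    (hf' : ∀ t ∈ Icc (0 : ℝ) 1, HasDerivAt f' (f'' (z + t * w)) (z + t * w))
    (hf'' : ContinuousOn (fun t : ℝ => f'' (z + t * w)) (Icc 0 1)) :
    f (z + w) - f z - w • f' z = ∫ t in (0 : ℝ)..1, (w ^ 2 * (1 - t)) • f'' (z + t * w) := by
  rw [← uIcc_of_le zero_le_one] at hf hf' hf''
  have hline (t : ℝ) : HasDerivAt (fun t : ℝ => z + t * w) w t := by
    simpa using (ofRealCLM.hasDerivAt.mul_const w).const_add z
  have hlin (t : ℝ) : HasDerivAt (fun t : ℝ => w * (1 - t)) (-w) t := by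
    simpa using ((ofRealCLM.hasDerivAt (x := t)).const_sub 1).const_mul w
  have hderiv (t : ℝ) (ht : t ∈ uIcc (0 : ℝ) 1) :
      HasDerivAt (fun t : ℝ => f (z + t * w) + (w * (1 - t)) • f' (z + t * w))
        ((w ^ 2 * (1 - t)) • f'' (z + t * w)) t := by
    convert! ((hf t ht).scomp t (hline t)).add
      ((hlin t).smul ((hf' t ht).scomp t (hline t))) using 1
    simp only [Function.comp_apply]
    module
  rw [intervalIntegral.integral_eq_sub_of_hasDerivAt hderiv
    (ContinuousOn.smul (by fun_prop) hf'').intervalIntegrable]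
  simp only [ofReal_one, one_mul, sub_self, mul_zero, zero_smul, add_zero, ofReal_zero, zero_mul,
    sub_zero, mul_one]
  abel

theorem cexp_sub_one_sub_eq_integral (y : ℂ) :
    exp y - 1 - y = ∫ t in (0 : ℝ)..1, y ^ 2 * (1 - t) * exp (t * y) := by
  simpa using map_add_sub_sub_eq_integral (f := exp) (z := 0) (w := y)
    (fun _ _ => hasDerivAt_exp _) (fun _ _ => hasDerivAt_exp _) (by fun_prop)

/-- The second-order Taylor remainder at `l`, with increment `-w`, of `x ↦ x ^ α / (α (α - 1))`.
Up to the factor `Γ(2 - α)` this is the cumulant function of the one-sided tempered stable law with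
index `α` and tempering rate `l`, compensated to have mean zero. -/
noncomputable def temperedStableExponent (α l w : ℂ) : ℂ :=
  ((l - w) ^ α - l ^ α + w * α * l ^ (α - 1)) / (α * (α - 1))

theorem min_re_le_re_sub_ofReal_mul (l w : ℂ) {t : ℝ} (ht : t ∈ Icc (0 : ℝ) 1) :
    min l.re (l.re - w.re) ≤ (l - t * w).re := by
  simp only [sub_re, re_ofReal_mul]
  nlinarith [ht.1, ht.2, min_le_left l.re (l.re - w.re), min_le_right l.re (l.re - w.re)]

theorem re_sub_ofReal_mul_pos {l w : ℂ} (hl : 0 < l.re) (hw : w.re < l.re) {t : ℝ}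
    (ht : t ∈ Icc (0 : ℝ) 1) : 0 < (l - t * w).re :=
  (lt_min hl (sub_pos.2 hw)).trans_le (min_re_le_re_sub_ofReal_mul l w ht)

theorem temperedStableExponent_eq_integral {α l w : ℂ} (h0 : α ≠ 0) (h1 : α ≠ 1) (hl : 0 < l.re)
    (hw : w.re < l.re) :
    temperedStableExponent α l w
      = ∫ t in (0 : ℝ)..1, w ^ 2 * (1 - t) * (l - t * w) ^ (α - 2) := by
  have h1' : α - 1 ≠ 0 := sub_ne_zero.2 h1
  have hslit (t : ℝ) (ht : t ∈ Icc (0 : ℝ) 1) : l + t * -w ∈ slitPlane := by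
    left
    simpa [sub_eq_add_neg] using re_sub_ofReal_mul_pos hl hw ht
  have hTaylor := map_add_sub_sub_eq_integral (f := fun x => x ^ α / (α * (α - 1)))
    (f' := fun x => x ^ (α - 1) / (α - 1)) (f'' := fun x => x ^ (α - 2)) (z := l) (w := -w)
    (fun t ht => ?_) (fun t ht => ?_)
    (ContinuousOn.cpow (by fun_prop) continuousOn_const hslit)
  · simp only [smul_eq_mul, neg_sq, mul_neg, ← sub_eq_add_neg] at hTaylor
    rw [← hTaylor, temperedStableExponent]
    field_simp
    ring
  · convert! (hasStrictDerivAt_cpow_const (hslit t ht)).hasDerivAt.div_const (α * (α - 1)) using 1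
    field_simp
  · convert! (hasStrictDerivAt_cpow_const (hslit t ht)).hasDerivAt.div_const (α - 1) using 1
    rw [show α - 1 - 1 = α - 2 by ring]
    field_simp

theorem mul_ofReal_cpow (z : ℂ) {r : ℝ} (hr : 0 < r) (c : ℂ) :
    (z * r) ^ c = z ^ c * (r : ℂ) ^ c := by
  rcases eq_or_ne z 0 with rfl | hz
  · rcases eq_or_ne c 0 with rfl | hc <;> simp [*]
  have hr0 : (r : ℂ) ≠ 0 := ofReal_ne_zero.2 hr.ne'
  rw [cpow_def_of_ne_zero (mul_ne_zero hz hr0), cpow_def_of_ne_zero hz, cpow_def_of_ne_zero hr0,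
    log_mul_ofReal _ hr _ hz, ofReal_log hr.le, ← exp_add, add_mul, add_comm]

theorem temperedStableExponent_mul_ofReal (α l w : ℂ) {r : ℝ} (hr : 0 < r) :
    temperedStableExponent α (l * r) (w * r) = (r : ℂ) ^ α * temperedStableExponent α l w := by
  have hr0 : (r : ℂ) ≠ 0 := ofReal_ne_zero.2 hr.ne'
  simp only [temperedStableExponent, ← sub_mul, mul_ofReal_cpow _ hr, cpow_sub _ _ hr0, cpow_one]
  field_simp

/-- The integrand in `(t, x)` which gives a tempered stable Lévy integrand after integration over
`t ∈ [0, 1]`, and a Gamma integral after integration over `x > 0`. -/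
noncomputable def temperedStableKernel (α : ℝ) (l w : ℂ) (t x : ℝ) : ℂ :=
  w ^ 2 * (1 - t) * ((x ^ (1 - α) : ℝ) * exp (-(l - t * w) * x))

theorem integral_temperedStableKernel (α : ℝ) (l w : ℂ) {x : ℝ} (hx : 0 < x) :
    ∫ t in (0 : ℝ)..1, temperedStableKernel α l w t x
      = (x ^ (-1 - α) : ℝ) * exp (-l * x) * (exp (w * x) - 1 - w * x) := by
  rw [cexp_sub_one_sub_eq_integral, ← intervalIntegral.integral_const_mul]
  refine intervalIntegral.integral_congr fun t _ => ?_
  have hpow : x ^ (1 - α) = x ^ (-1 - α) * x ^ 2 := by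
    rw [← Real.rpow_natCast, ← Real.rpow_add hx]
    congr 1
    push_cast
    ring
  have hexp : exp (-(l - t * w) * x) = exp (-l * x) * exp (t * (w * x)) := by
    rw [← exp_add]
    ring_nf
  simp only [temperedStableKernel, hpow, hexp]
  push_cast
  ring

theorem integrable_temperedStableKernel {α : ℝ} (hα : α < 2) {l w : ℂ} (hl : 0 < l.re)
    (hw : w.re < l.re) :
    Integrable (Function.uncurry (temperedStableKernel α l w))
      ((volume.restrict (uIoc (0 : ℝ) 1)).prod (volume.restrict (Ioi (0 : ℝ)))) := by
  set m := min l.re (l.re - w.re)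
  have hm0 : 0 < m := lt_min hl (sub_pos.2 hw)
  have hfst : IntegrableOn (fun t : ℝ => w ^ 2 * (1 - t)) (uIoc 0 1) :=
    intervalIntegrable_iff.1 (Continuous.intervalIntegrable (by fun_prop) _ _)
  have hsnd := integrableOn_rpow_mul_exp_neg_mul (s := 2 - α) (sub_pos.2 hα) hm0
  refine (hfst.norm.mul_prod hsnd).mono' ?_ ?_
  · unfold temperedStableKernel Function.uncurry
    fun_prop
  rw [Measure.prod_restrict, uIoc_of_le zero_le_one]
  filter_upwards [ae_restrict_mem (measurableSet_Ioc.prod measurableSet_Ioi)]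
    with ⟨t, x⟩ ⟨⟨ht0, ht1⟩, (hx : 0 < x)⟩
  have hrate : m ≤ (l - t * w).re := min_re_le_re_sub_ofReal_mul l w ⟨ht0.le, ht1⟩
  simp only [Function.uncurry, temperedStableKernel]
  rw [norm_mul, norm_mul (ofReal _), norm_exp, norm_real, Real.norm_of_nonneg (by positivity),
    show 2 - α - 1 = 1 - α by ring]
  gcongr
  simp only [neg_mul, neg_re, re_mul_ofReal]
  gcongr

theorem integral_temperedStableKernel_Ioi {α : ℝ} (hα : α < 2) {l w : ℂ} (hl : 0 < l.re)
    (hw : w.re < l.re) {t : ℝ} (ht : t ∈ Icc (0 : ℝ) 1) :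
    ∫ x in Ioi (0 : ℝ), temperedStableKernel α l w t x
      = Real.Gamma (2 - α) * (w ^ 2 * (1 - t) * (l - t * w) ^ ((α : ℂ) - 2)) := by
  have hGamma := integral_rpow_mul_cexp_neg_mul_Ioi (sub_pos.2 hα) (re_sub_ofReal_mul_pos hl hw ht)
  rw [show 2 - α - 1 = 1 - α by ring] at hGamma
  simp only [temperedStableKernel]
  rw [integral_const_mul, hGamma]
  push_cast
  ring_nf

theorem integrableOn_temperedStable {α : ℝ} (hα : α < 2) {l w : ℂ} (hl : 0 < l.re)
    (hw : w.re < l.re) :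
    IntegrableOn (fun x : ℝ => (x ^ (-1 - α) : ℝ) * exp (-l * x) * (exp (w * x) - 1 - w * x))
      (Ioi 0) := by
  refine IntegrableOn.congr_fun (integrable_temperedStableKernel hα hl hw).integral_prod_right
    (fun x hx => ?_) measurableSet_Ioi
  rw [← integral_temperedStableKernel α l w hx, intervalIntegral.integral_of_le zero_le_one,
    uIoc_of_le zero_le_one]
  rfl

theorem integral_temperedStable {α : ℝ} (h0 : α ≠ 0) (h1 : α ≠ 1) (hα : α < 2) {l w : ℂ}
    (hl : 0 < l.re) (hw : w.re < l.re) :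
    ∫ x in Ioi (0 : ℝ), (x ^ (-1 - α) : ℝ) * exp (-l * x) * (exp (w * x) - 1 - w * x)
      = Real.Gamma (2 - α) * temperedStableExponent α l w := by
  calc
    _ = ∫ x in Ioi (0 : ℝ), ∫ t in (0 : ℝ)..1, temperedStableKernel α l w t x :=
      setIntegral_congr_fun measurableSet_Ioi fun x hx =>
        (integral_temperedStableKernel α l w hx).symm
    _ = ∫ t in (0 : ℝ)..1, ∫ x in Ioi (0 : ℝ), temperedStableKernel α l w t x :=
      (intervalIntegral_integral_swap (integrable_temperedStableKernel hα hl hw)).symm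
    _ = ∫ t in (0 : ℝ)..1, Real.Gamma (2 - α) *
          (w ^ 2 * (1 - t) * (l - t * w) ^ ((α : ℂ) - 2)) :=
      intervalIntegral.integral_congr fun t ht =>
        integral_temperedStableKernel_Ioi hα hl hw (by rwa [uIcc_of_le zero_le_one] at ht)
    _ = Real.Gamma (2 - α) * temperedStableExponent α l w := by
      rw [intervalIntegral.integral_const_mul, temperedStableExponent_eq_integral
        (ofReal_ne_zero.2 h0) (ofReal_eq_one.not.2 h1) hl hw]

end TemperedStableIntegral

section StdCTS

open Complex Set

variable {α lp lm : ℝ}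

theorem integrable_of_integrableOn_Ioi_comp_neg {E : Type*} [NormedAddCommGroup E] {f : ℝ → E}
    (hneg : IntegrableOn (fun x => f (-x)) (Ioi 0)) (hpos : IntegrableOn f (Ioi 0)) :
    Integrable f := by
  have hIic : IntegrableOn f (Iic 0) := by
    rw [integrableOn_Iic_iff_integrableOn_Iio, ← neg_zero, ← neg_Ioi]
    exact ((Measure.measurePreserving_neg (volume : Measure ℝ)).integrableOn_comp_preimage
      (Homeomorph.neg ℝ).measurableEmbedding).1 (by simpa [Function.comp_def] using hneg)
  simpa [← integrableOn_univ] using hIic.union hpos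

theorem integral_eq_integral_Ioi_comp_neg_add {E : Type*} [NormedAddCommGroup E]
    [NormedSpace ℝ E] {f : ℝ → E} (hf : Integrable f) :
    ∫ x, f x = (∫ x in Ioi 0, f (-x)) + ∫ x in Ioi 0, f x := by
  rw [integral_comp_neg_Ioi, neg_zero,
    intervalIntegral.integral_Iic_add_Ioi hf.integrableOn hf.integrableOn]

theorem stdCTSConst_comm (α lp lm : ℝ) : stdCTSConst α lp lm = stdCTSConst α lm lp := by
  rw [stdCTSConst, stdCTSConst, add_comm]

theorem stdCTSConst_pos (hα : α < 2) (hlp : 0 < lp) (hlm : 0 < lm) :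
    0 < stdCTSConst α lp lm := by
  have := Real.Gamma_pos_of_pos (sub_pos.2 hα)
  unfold stdCTSConst
  positivity

theorem Gamma_mul_stdCTSConst (hα : α < 2) (lp lm : ℝ) :
    Real.Gamma (2 - α) * stdCTSConst α lp lm = (lp ^ (α - 2) + lm ^ (α - 2))⁻¹ := by
  have := (Real.Gamma_pos_of_pos (sub_pos.2 hα)).ne'
  rw [stdCTSConst, one_div, mul_inv, mul_inv_cancel_left₀ this]

theorem stdCTSLevyDensity_nonneg (hα : α < 2) (hlp : 0 < lp) (hlm : 0 < lm) (x : ℝ) :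
    0 ≤ stdCTSLevyDensity α lp lm x := by
  have := stdCTSConst_pos hα hlp hlm
  unfold stdCTSLevyDensity
  split_ifs <;> positivity

theorem measurable_stdCTSLevyDensity (α lp lm : ℝ) : Measurable (stdCTSLevyDensity α lp lm) := by
  unfold stdCTSLevyDensity
  exact Measurable.ite measurableSet_Ioi (by fun_prop)
    (Measurable.ite measurableSet_Iio (by fun_prop) (by fun_prop))

theorem stdCTSLevyDensity_of_pos (α lp lm : ℝ) {x : ℝ} (hx : 0 < x) :
    stdCTSLevyDensity α lp lm x
      = stdCTSConst α lp lm * (x ^ (-1 - α) * Real.exp (-lp * x)) := by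
  rw [stdCTSLevyDensity, if_pos hx, show -1 - α = -(1 + α) by ring, Real.rpow_neg hx.le]
  ring

theorem stdCTSLevyDensity_neg (α lp lm x : ℝ) :
    stdCTSLevyDensity α lp lm (-x) = stdCTSLevyDensity α lm lp x := by
  rcases lt_trichotomy x 0 with hx | rfl | hx
  · simp [stdCTSLevyDensity, hx, hx.not_gt, abs_of_neg hx, stdCTSConst_comm α lp lm]
  · simp [stdCTSLevyDensity]
  · simp [stdCTSLevyDensity, hx, hx.not_gt, abs_of_pos hx, stdCTSConst_comm α lp lm]

/-- The integrand of the Lévy–Khintchine formula for `stdCTS(α, lp, lm)` at `u`, with respect to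
Lebesgue measure. -/
noncomputable def stdCTSLevyIntegrand (α lp lm u x : ℝ) : ℂ :=
  stdCTSLevyDensity α lp lm x • (exp (I * u * x) - 1 - I * u * x)

theorem stdCTSLevyIntegrand_neg (α lp lm u x : ℝ) :
    stdCTSLevyIntegrand α lp lm u (-x) = stdCTSLevyIntegrand α lm lp (-u) x := by
  simp [stdCTSLevyIntegrand, stdCTSLevyDensity_neg]

theorem stdCTSLevyIntegrand_of_pos (α lp lm u : ℝ) {x : ℝ} (hx : 0 < x) :
    stdCTSLevyIntegrand α lp lm u x
      = stdCTSConst α lp lm *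
        ((x ^ (-1 - α) : ℝ) * exp (-lp * x) * (exp (I * u * x) - 1 - I * u * x)) := by
  rw [stdCTSLevyIntegrand, stdCTSLevyDensity_of_pos α lp lm hx, real_smul]
  push_cast
  ring

theorem integrableOn_Ioi_stdCTSLevyIntegrand (hα : α < 2) (hlp : 0 < lp) (lm u : ℝ) :
    IntegrableOn (stdCTSLevyIntegrand α lp lm u) (Ioi 0) :=
  IntegrableOn.congr_fun
    ((integrableOn_temperedStable hα (l := lp) (w := I * u) (by simpa) (by simpa)).const_mul
      (stdCTSConst α lp lm : ℂ))
    (fun _ hx => (stdCTSLevyIntegrand_of_pos α lp lm u hx).symm) measurableSet_Ioi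

theorem integral_Ioi_stdCTSLevyIntegrand (h0 : α ≠ 0) (h1 : α ≠ 1) (hα : α < 2) (hlp : 0 < lp)
    (lm u : ℝ) :
    ∫ x in Ioi 0, stdCTSLevyIntegrand α lp lm u x
      = temperedStableExponent α lp (I * u) / (lp ^ (α - 2) + lm ^ (α - 2) : ℝ) := by
  rw [setIntegral_congr_fun measurableSet_Ioi fun x hx =>
      stdCTSLevyIntegrand_of_pos α lp lm u hx, integral_const_mul,
    integral_temperedStable h0 h1 hα (by simpa) (by simpa), div_eq_inv_mul, ← ofReal_inv,
    ← Gamma_mul_stdCTSConst hα]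
  push_cast
  ring

theorem integrable_stdCTSLevyIntegrand (hα : α < 2) (hlp : 0 < lp) (hlm : 0 < lm) (u : ℝ) :
    Integrable (stdCTSLevyIntegrand α lp lm u) := by
  refine integrable_of_integrableOn_Ioi_comp_neg ?_
    (integrableOn_Ioi_stdCTSLevyIntegrand hα hlp lm u)
  simpa only [stdCTSLevyIntegrand_neg] using integrableOn_Ioi_stdCTSLevyIntegrand hα hlm lp (-u)

theorem stdCTSExponent_eq_temperedStableExponent (h0 : α ≠ 0) (h1 : α ≠ 1) (hlp : 0 < lp)
    (hlm : 0 < lm) (u : ℝ) :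
    stdCTSExponent u lp lm α
      = (temperedStableExponent α lp (I * u) + temperedStableExponent α lm (-(I * u)))
        / (lp ^ (α - 2) + lm ^ (α - 2) : ℝ) := by
  have h0' : (α : ℂ) ≠ 0 := ofReal_ne_zero.2 h0
  have h1' : (α : ℂ) - 1 ≠ 0 := sub_ne_zero.2 (ofReal_eq_one.not.2 h1)
  have hsum : ((lp ^ (α - 2) + lm ^ (α - 2) : ℝ) : ℂ) ≠ 0 := by
    rw [ofReal_ne_zero]
    positivity
  have hcast : (lp : ℂ) ^ ((α : ℂ) - 2) + (lm : ℂ) ^ ((α : ℂ) - 2)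
      = (lp ^ (α - 2) + lm ^ (α - 2) : ℝ) := by
    push_cast [ofReal_cpow hlp.le, ofReal_cpow hlm.le]
    rfl
  rw [stdCTSExponent, temperedStableExponent, temperedStableExponent, hcast]
  field_simp
  ring_nf

theorem integral_stdCTSLevyIntegrand (h0 : α ≠ 0) (h1 : α ≠ 1) (hα : α < 2) (hlp : 0 < lp)
    (hlm : 0 < lm) (u : ℝ) :
    ∫ x, stdCTSLevyIntegrand α lp lm u x = stdCTSExponent u lp lm α := by
  rw [integral_eq_integral_Ioi_comp_neg_add (integrable_stdCTSLevyIntegrand hα hlp hlm u)]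
  simp_rw [stdCTSLevyIntegrand_neg]
  rw [integral_Ioi_stdCTSLevyIntegrand h0 h1 hα hlm, integral_Ioi_stdCTSLevyIntegrand h0 h1 hα hlp,
    stdCTSExponent_eq_temperedStableExponent h0 h1 hlp hlm, add_comm (lm ^ _), ← add_div,
    add_comm (temperedStableExponent _ _ _), ofReal_neg, mul_neg]

theorem integral_stdCTSLevyMeasure (h0 : α ≠ 0) (h1 : α ≠ 1) (hα : α < 2) (hlp : 0 < lp)
    (hlm : 0 < lm) (u : ℝ) :
    ∫ x, (exp (I * u * x) - 1 - I * u * x) ∂(stdCTSLevyMeasure α lp lm)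
      = stdCTSExponent u lp lm α := by
  have hdensity := (measurable_stdCTSLevyDensity α lp lm).ennreal_ofReal
  rw [stdCTSLevyMeasure, integral_withDensity_eq_integral_toReal_smul hdensity (by simp)]
  simp_rw [ENNReal.toReal_ofReal (stdCTSLevyDensity_nonneg hα hlp hlm _)]
  exact integral_stdCTSLevyIntegrand h0 h1 hα hlp hlm u

theorem stdCTSExponent_two (u lp lm : ℝ) : stdCTSExponent u lp lm 2 = (-u ^ 2 / 2 : ℝ) := by
  simp only [stdCTSExponent, ofReal_ofNat, sub_self, cpow_zero, cpow_ofNat,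
    show (2 : ℂ) - 1 = 1 by norm_num, cpow_one]
  push_cast
  linear_combination (u : ℂ) ^ 2 / 2 * I_sq

theorem IsStdCTS.charFun_eq (h0 : α ≠ 0) (h1 : α ≠ 1) (h2 : α ≤ 2) (hlp : 0 < lp)
    (hlm : 0 < lm) {ρ : Measure ℝ} (hρ : IsStdCTS α lp lm ρ) (t : ℝ) :
    charFun ρ t = exp (stdCTSExponent t lp lm α) := by
  rcases h2.lt_or_eq with h | rfl
  · rw [hρ.2.1 h, integral_stdCTSLevyMeasure h0 h1 h hlp hlm]
  · rw [hρ.2.2 rfl, stdCTSExponent_two, charFun_gaussianReal]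
    simp [neg_div]

theorem stdCTSExponent_re_nonpos (h0 : α ≠ 0) (h1 : α ≠ 1) (h2 : α ≤ 2) (hlp : 0 < lp)
    (hlm : 0 < lm) (u : ℝ) : (stdCTSExponent u lp lm α).re ≤ 0 := by
  rcases h2.lt_or_eq with h | rfl
  · rw [← integral_stdCTSLevyIntegrand h0 h1 h hlp hlm]
    rw [← RCLike.re_to_complex, ← integral_re (integrable_stdCTSLevyIntegrand h hlp hlm u)]
    refine integral_nonpos fun x => ?_
    rw [stdCTSLevyIntegrand, real_smul, RCLike.re_to_complex, re_ofReal_mul]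
    refine mul_nonpos_of_nonneg_of_nonpos (stdCTSLevyDensity_nonneg h hlp hlm x) ?_
    simp [exp_re, Real.cos_le_one]
  · rw [stdCTSExponent_two, ofReal_re]
    nlinarith [sq_nonneg u]

theorem stdCTSExponent_mul (h0 : α ≠ 0) (h1 : α ≠ 1) (hlp : 0 < lp) (hlm : 0 < lm) {r : ℝ}
    (hr : 0 < r) (u : ℝ) :
    stdCTSExponent (u * r) (lp * r) (lm * r) α = (r : ℂ) ^ 2 * stdCTSExponent u lp lm α := by
  have hrα : (r : ℂ) ^ (α : ℂ) = (r ^ (α - 2) : ℝ) * (r : ℂ) ^ 2 := by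
    rw [← ofReal_cpow hr.le, ← ofReal_pow, ← ofReal_mul, ← Real.rpow_natCast, ← Real.rpow_add hr]
    simp
  have hr0 : ((r ^ (α - 2) : ℝ) : ℂ) ≠ 0 := ofReal_ne_zero.2 (by positivity)
  rw [stdCTSExponent_eq_temperedStableExponent h0 h1 (mul_pos hlp hr) (mul_pos hlm hr),
    stdCTSExponent_eq_temperedStableExponent h0 h1 hlp hlm, Real.mul_rpow hlp.le hr.le,
    Real.mul_rpow hlm.le hr.le, ← add_mul]
  simp only [ofReal_mul]
  rw [← mul_assoc, ← neg_mul, temperedStableExponent_mul_ofReal _ _ _ hr,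
    temperedStableExponent_mul_ofReal _ _ _ hr, hrα]
  field_simp

end StdCTS

section InfinitelyDivisible

open Complex Set Filter Topology

variable {Ω ι : Type*} [MeasurableSpace Ω] {P : Measure Ω}

theorem integral_cexp_sum_mul_eq_prod_complexMGF [Fintype ι] {X : ι → Ω → ℝ}
    (hX : iIndepFun X P) (mX : ∀ i, AEMeasurable (X i) P) (z : ι → ℂ) :
    ∫ ω, exp (∑ i, z i * X i ω) ∂P = ∏ i, complexMGF (X i) P (z i) := by
  simp_rw [exp_sum]
  exact hX.integral_fun_prod_comp (f := fun i (x : ℝ) => exp (z i * x)) mX (fun i => by fun_prop)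

theorem complexMGF_id_map_sum_pi [Fintype ι] (ν : Measure ℝ) [IsProbabilityMeasure ν] (z : ℂ) :
    complexMGF id ((Measure.pi fun _ : ι => ν).map fun x => ∑ i, x i) z
      = complexMGF id ν z ^ Fintype.card ι := by
  have hindep : iIndepFun (fun (i : ι) (x : ι → ℝ) => x i) (Measure.pi fun _ => ν) :=
    iIndepFun_pi (X := fun _ => id) fun _ => aemeasurable_id
  have hmarginal (i : ι) :
      complexMGF (fun x : ι → ℝ => x i) (Measure.pi fun _ => ν) z = complexMGF id ν z := by
    rw [← complexMGF_id_map (measurable_pi_apply i).aemeasurable]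
    exact congrArg (complexMGF id · z) (measurePreserving_eval (fun _ : ι => ν) i).map_eq
  rw [complexMGF_id_map (by fun_prop), complexMGF]
  simp_rw [ofReal_sum, Finset.mul_sum]
  rw [integral_cexp_sum_mul_eq_prod_complexMGF hindep
    (fun i => (measurable_pi_apply i).aemeasurable) fun _ => z]
  simp [hmarginal]

theorem mgf_id_map_sum_pi [Fintype ι] (ν : Measure ℝ) [IsProbabilityMeasure ν] (t : ℝ) :
    mgf id ((Measure.pi fun _ : ι => ν).map fun x => ∑ i, x i) t
      = mgf id ν t ^ Fintype.card ι := by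
  have h := complexMGF_id_map_sum_pi (ι := ι) ν t
  simp only [complexMGF_ofReal] at h
  exact_mod_cast h

theorem ae_nonneg_of_ae_nonneg_map_sum_pi [Fintype ι] [Nonempty ι] {ν : Measure ℝ}
    [SigmaFinite ν]
    (h : ∀ᵐ x ∂((Measure.pi fun _ : ι => ν).map fun x => ∑ i, x i), 0 ≤ x) :
    ∀ᵐ x ∂ν, 0 ≤ x := by
  rw [ae_map_iff (by fun_prop) measurableSet_Ici, ae_iff] at h
  have hsub : univ.pi (fun _ : ι => Iio (0 : ℝ)) ⊆ {x | ¬ 0 ≤ ∑ i, x i} := fun x hx =>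
    not_le.2 (Finset.sum_neg (fun i _ => hx i (mem_univ i)) Finset.univ_nonempty)
  have hpow := measure_mono_null hsub h
  rw [Measure.pi_pi, Finset.prod_const, pow_eq_zero_iff (by simp)] at hpow
  simp only [ae_iff, not_le]
  exact hpow

theorem norm_cexp_le_one {y : ℂ} (hy : y.re ≤ 0) : ‖exp y‖ ≤ 1 := by
  rwa [norm_exp, Real.exp_le_one_iff]

theorem norm_one_sub_cexp_le_norm {y : ℂ} (hy : y.re ≤ 0) : ‖1 - exp y‖ ≤ ‖y‖ := by
  simpa using (convex_halfSpace_re_le 0).norm_image_sub_le_of_norm_deriv_le (f := exp) (C := 1)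
    (fun _ _ => differentiableAt_exp) (fun w hw => by simpa using norm_cexp_le_one hw) hy
    (by simp : (0 : ℂ).re ≤ 0)

theorem div_one_add_le_one_sub_exp_neg {x : ℝ} (hx : 0 ≤ x) :
    x / (1 + x) ≤ 1 - Real.exp (-x) := by
  have hinv : Real.exp (-x) ≤ (1 + x)⁻¹ := by
    rw [Real.exp_neg]
    exact inv_anti₀ (by positivity) (by linarith [Real.add_one_le_exp x])
  calc
    x / (1 + x) = 1 - (1 + x)⁻¹ := by field_simp; ring
    _ ≤ 1 - Real.exp (-x) := by linarith

theorem re_mul_ofReal_nonpos {z : ℂ} (hz : z.re ≤ 0) {x : ℝ} (hx : 0 ≤ x) : (z * x).re ≤ 0 := by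
  rw [re_mul_ofReal]
  exact mul_nonpos_of_nonpos_of_nonneg hz hx

theorem norm_one_sub_cexp_mul_le {z : ℂ} (hz : z.re ≤ 0) {x : ℝ} (hx : 0 ≤ x) :
    ‖1 - exp (z * x)‖ ≤ (2 + ‖z‖) * (1 - Real.exp (-x)) := by
  have hre := re_mul_ofReal_nonpos hz hx
  have hlin : ‖1 - exp (z * x)‖ ≤ ‖z‖ * x := by
    simpa [abs_of_nonneg hx] using norm_one_sub_cexp_le_norm hre
  have htwo : ‖1 - exp (z * x)‖ ≤ 2 := by
    linarith [norm_sub_le 1 (exp (z * x)), norm_cexp_le_one hre, norm_one (α := ℂ)]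
  calc
    ‖1 - exp (z * x)‖ ≤ (2 + ‖z‖) * (x / (1 + x)) := by
      rw [← mul_div_assoc, le_div_iff₀ (by positivity)]
      nlinarith
    _ ≤ (2 + ‖z‖) * (1 - Real.exp (-x)) := by
      gcongr
      exact div_one_add_le_one_sub_exp_neg hx

theorem integrable_cexp_mul_of_re_nonpos [IsFiniteMeasure P] {V : Ω → ℝ} (hV : AEMeasurable V P)
    (h0 : ∀ᵐ ω ∂P, 0 ≤ V ω) {z : ℂ} (hz : z.re ≤ 0) :
    Integrable (fun ω => exp (z * V ω)) P := by
  refine Integrable.of_bound (by fun_prop) 1 ?_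
  filter_upwards [h0] with ω hω using norm_cexp_le_one (re_mul_ofReal_nonpos hz hω)

theorem integrable_exp_neg_of_nonneg [IsFiniteMeasure P] {V : Ω → ℝ} (hV : AEMeasurable V P)
    (h0 : ∀ᵐ ω ∂P, 0 ≤ V ω) : Integrable (fun ω => Real.exp (-V ω)) P := by
  refine Integrable.of_bound (by fun_prop) 1 ?_
  filter_upwards [h0] with ω hω
  simpa using hω

theorem norm_one_sub_complexMGF_le [IsProbabilityMeasure P] {V : Ω → ℝ} (hV : AEMeasurable V P)
    (h0 : ∀ᵐ ω ∂P, 0 ≤ V ω) {z : ℂ} (hz : z.re ≤ 0) :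
    ‖1 - complexMGF V P z‖ ≤ (2 + ‖z‖) * (1 - mgf V P (-1)) := by
  have hexp := integrable_exp_neg_of_nonneg hV h0
  calc
    ‖1 - complexMGF V P z‖ = ‖∫ ω, (1 - exp (z * V ω)) ∂P‖ := by
      rw [integral_sub (integrable_const 1) (integrable_cexp_mul_of_re_nonpos hV h0 hz)]
      simp [complexMGF]
    _ ≤ ∫ ω, (2 + ‖z‖) * (1 - Real.exp (-V ω)) ∂P := by
      refine norm_integral_le_of_norm_le (((integrable_const 1).sub hexp).const_mul _) ?_
      filter_upwards [h0] with ω hω using norm_one_sub_cexp_mul_le hz hω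
    _ = (2 + ‖z‖) * (1 - mgf V P (-1)) := by
      rw [integral_const_mul, integral_sub (integrable_const 1) hexp]
      simp [mgf]

theorem IsInfinitelyDivisible.complexMGF_id_ne_zero {ρ : Measure ℝ} [IsProbabilityMeasure ρ]
    (hρ : IsInfinitelyDivisible ρ) (h0 : ∀ᵐ x ∂ρ, 0 ≤ x) {z : ℂ} (hz : z.re ≤ 0) :
    complexMGF id ρ z ≠ 0 := by
  set c := mgf id ρ (-1)
  have hc : 0 < c := mgf_pos (by simpa using integrable_exp_neg_of_nonneg aemeasurable_id h0)
  have hlim : Tendsto (fun n : ℕ => (2 + ‖z‖) * (1 - c ^ ((n : ℝ)⁻¹))) atTop (𝓝 0) := by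
    have hroot : Tendsto (fun n : ℕ => c ^ ((n : ℝ)⁻¹)) atTop (𝓝 (c ^ (0 : ℝ))) :=
      (Real.continuous_const_rpow hc.ne').continuousAt.tendsto.comp
        tendsto_inv_atTop_nhds_zero_nat
    simpa using (hroot.const_sub 1).const_mul (2 + ‖z‖)
  obtain ⟨n, hn, hn1⟩ := ((hlim.eventually_lt_const one_pos).and (eventually_ge_atTop 1)).exists
  obtain ⟨ν, hν, rfl⟩ := hρ n hn1
  have : NeZero n := ⟨Nat.one_le_iff_ne_zero.1 hn1⟩
  have hνc : mgf id ν (-1) = c ^ ((n : ℝ)⁻¹) := by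
    rw [show c = mgf id ν (-1) ^ n by simpa using mgf_id_map_sum_pi (ι := Fin n) ν (-1),
      Real.pow_rpow_inv_natCast mgf_nonneg (NeZero.ne n)]
  have hclose : ‖1 - complexMGF id ν z‖ < 1 := by
    refine (norm_one_sub_complexMGF_le aemeasurable_id
      (ae_nonneg_of_ae_nonneg_map_sum_pi h0) hz).trans_lt ?_
    rwa [hνc]
  rw [complexMGF_id_map_sum_pi]
  refine pow_ne_zero _ fun hzero => ?_
  simp [hzero] at hclose

theorem IsInfinitelyDivisible.complexMGF_ne_zero [IsProbabilityMeasure P] {V : Ω → ℝ}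
    (hdiv : IsInfinitelyDivisible (P.map V)) (hV : AEMeasurable V P) (h0 : ∀ᵐ ω ∂P, 0 ≤ V ω)
    {z : ℂ} (hz : z.re ≤ 0) : complexMGF V P z ≠ 0 := by
  have := Measure.isProbabilityMeasure_map hV
  rw [← complexMGF_id_map hV]
  exact hdiv.complexMGF_id_ne_zero ((ae_map_iff hV measurableSet_Ici).2 h0) hz

end InfinitelyDivisible

section Conditioning

open Complex

variable {Ω : Type*} [MeasurableSpace Ω] {P : Measure Ω}

theorem charFun_map_toLp_add_mul {ι : Type*} [Fintype ι] [IsProbabilityMeasure P]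
    {X : ι → Ω → ℝ} (hX : iIndepFun X P) (mX : ∀ i, AEMeasurable (X i) P) (m s : ι → ℝ)
    (u : EuclideanSpace ℝ ι) :
    charFun (P.map fun ω => WithLp.toLp 2 fun i => m i + s i * X i ω) u
      = exp (I * ∑ i, (u i : ℂ) * m i) * ∏ i, charFun (P.map (X i)) (s i * u i) := by
  have hindep : iIndepFun (fun i ω => m i + s i * X i ω) P :=
    hX.comp (fun i x => m i + s i * x) fun i => by fun_prop
  have haffine (i : ι) : charFun (P.map fun ω => m i + s i * X i ω) (u i)
      = exp (I * (u i * m i)) * charFun (P.map (X i)) (s i * u i) := by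
    have hmap : P.map (fun ω => m i + s i * X i ω)
        = ((P.map (X i)).map (s i * ·)).map (m i + ·) := by
      rw [AEMeasurable.map_map_of_aemeasurable (by fun_prop) (mX i),
        AEMeasurable.map_map_of_aemeasurable (by fun_prop) (by fun_prop)]
      rfl
    rw [hmap, charFun_map_const_add, charFun_map_mul, mul_comm]
    simp [mul_comm]
  rw [(iIndepFun_iff_charFun_pi fun i => by fun_prop).1 hindep u, Finset.mul_sum, exp_sum,
    ← Finset.prod_mul_distrib]
  exact Finset.prod_congr rfl fun i _ => haffine i

variable {α β : Type*} [MeasurableSpace α] [MeasurableSpace β] [StandardBorelSpace β] [Nonempty β]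
  [IsFiniteMeasure P] {T : Ω → α} {W : Ω → β}

theorem integral_prodMk_eq_integral_condDistrib {E : Type*} [NormedAddCommGroup E]
    [NormedSpace ℝ E] [CompleteSpace E] (hT : Measurable T) (hW : AEMeasurable W P) {f : α × β → E}
    (hf : StronglyMeasurable f) (hint : Integrable (fun ω => f (T ω, W ω)) P) :
    ∫ ω, f (T ω, W ω) ∂P = ∫ ω, ∫ w, f (T ω, w) ∂(condDistrib W T P (T ω)) ∂P := by
  rw [← integral_condExp hT.comap_le]
  exact integral_congr_ae (condExp_prod_ae_eq_integral_condDistrib hT hW hf hint)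

theorem charFun_map_prodMk_eq_integral_condDistrib {E : Type*} [NormedAddCommGroup E]
    [InnerProductSpace ℝ E] [MeasurableSpace E] [BorelSpace E] [SecondCountableTopology E]
    (hT : Measurable T) (hW : AEMeasurable W P) {g : α × β → E} (hg : Measurable g) (u : E) :
    charFun (P.map fun ω => g (T ω, W ω)) u
      = ∫ ω, charFun ((condDistrib W T P (T ω)).map fun w => g (T ω, w)) u ∂P := by
  have hgTW : AEMeasurable (fun ω => g (T ω, W ω)) P :=
    hg.comp_aemeasurable (hT.aemeasurable.prodMk hW)
  have hf : StronglyMeasurable fun p => exp (inner ℝ (g p) u * I) :=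
    Measurable.stronglyMeasurable (by fun_prop)
  have hint : Integrable (fun ω => exp (inner ℝ (g (T ω, W ω)) u * I)) P :=
    Integrable.of_bound (AEMeasurable.aestronglyMeasurable (by fun_prop)) 1
      (.of_forall fun ω => by simp [norm_exp])
  simp_rw [charFun_apply]
  rw [integral_map hgTW (by fun_prop), integral_prodMk_eq_integral_condDistrib hT hW hf hint]
  congr with ω
  have hgT : Measurable fun w => g (T ω, w) := hg.comp measurable_prodMk_left
  rw [integral_map hgT.aemeasurable (by fun_prop)]

end Conditioning

section MixedTS

open Complex

variable {Ω : Type*} [MeasurableSpace Ω] {P : Measure Ω} [IsProbabilityMeasure P] {N : ℕ}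
  {μ β a α lp lm : Fin N → ℝ} {G : Fin N → Ω → ℝ} {Z : Ω → ℝ} {X : Fin N → Ω → ℝ}
  {Y : Ω → EuclideanSpace ℝ (Fin N)}

/-- The pair `((G₁, …, G_N), Z)` generating the σ-algebra `χ` conditionally on which the `X i` are
independent. -/
def mixingPair (G : Fin N → Ω → ℝ) (Z : Ω → ℝ) (ω : Ω) : (Fin N → ℝ) × ℝ :=
  (fun i => G i ω, Z ω)

/-- The mixing variable `V i = G i + a i Z`, as a function of the value `t = (g, z)` of
`mixingPair G Z`. -/
def mixingVar (a : Fin N → ℝ) (t : (Fin N → ℝ) × ℝ) (i : Fin N) : ℝ :=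
  t.1 i + a i * t.2

/-- The conditional law of `(X₁, …, X_N)` given `χ = σ(G₁, …, G_N, Z)`. -/
noncomputable def condLaw (P : Measure Ω) [IsProbabilityMeasure P] (G : Fin N → Ω → ℝ)
    (Z : Ω → ℝ) (X : Fin N → Ω → ℝ) (ω : Ω) : Measure (Fin N → ℝ) :=
  condDistrib (fun ω i => X i ω) (mixingPair G Z) P (mixingPair G Z ω)

/-- The MixedTS vector as a function of the values `p.1` of `mixingPair G Z` and `p.2` of
`(X₁, …, X_N)`. -/
noncomputable def mixedTSMap (μ β a : Fin N → ℝ) (p : ((Fin N → ℝ) × ℝ) × (Fin N → ℝ)) :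
    EuclideanSpace ℝ (Fin N) :=
  WithLp.toLp 2 fun i => (μ i + β i * mixingVar a p.1 i) + √(mixingVar a p.1 i) * p.2 i

/-- The point `i u β + L_stdCTS(u; λ₊, λ₋, α)` at which the cumulant function of a mixing variable
enters the characteristic function of the MixedTS vector. -/
noncomputable def mixedTSExponent (u β lp lm α : ℝ) : ℂ :=
  I * u * β + stdCTSExponent u lp lm α

theorem measurable_mixedTSMap (μ β a : Fin N → ℝ) : Measurable (mixedTSMap μ β a) := by
  unfold mixedTSMap mixingVar
  fun_prop

namespace IsMultivariateMixedTS

theorem measurable_mixingPair (hY : IsMultivariateMixedTS P μ β a α lp lm G Z X Y) :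
    Measurable (mixingPair G Z) :=
  (measurable_pi_lambda _ hY.measurable_G).prodMk hY.measurable_Z

theorem ae_eq_mixedTSMap (hY : IsMultivariateMixedTS P μ β a α lp lm G Z X Y) :
    Y =ᵐ[P] fun ω => mixedTSMap μ β a (mixingPair G Z ω, fun i => X i ω) := by
  filter_upwards [hY.Y_eq] with ω hω
  ext i
  exact hω i

theorem ae_mixingVar_nonneg (hY : IsMultivariateMixedTS P μ β a α lp lm G Z X Y) (i : Fin N) :
    ∀ᵐ ω ∂P, 0 ≤ mixingVar a (mixingPair G Z ω) i := by
  filter_upwards [hY.G_nonneg i, hY.Z_nonneg] with ω hG hZ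
  exact add_nonneg hG (mul_nonneg (hY.a_nonneg i) hZ)

theorem ae_charFun_condLaw_map_eval (hY : IsMultivariateMixedTS P μ β a α lp lm G Z X Y)
    (hα : ∀ h, α h ≠ 1) (t : ℝ) (i : Fin N) :
    ∀ᵐ ω ∂P, charFun ((condLaw P G Z X ω).map fun x => x i)
        (√(mixingVar a (mixingPair G Z ω) i) * t)
      = exp (mixingVar a (mixingPair G Z ω) i * stdCTSExponent t (lp i) (lm i) (α i)) := by
  filter_upwards [hY.cond_law i, hY.ae_mixingVar_nonneg i] with ω hlaw hV
  set V := mixingVar a (mixingPair G Z ω) i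
  rcases hV.eq_or_lt with h | h
  · have : IsProbabilityMeasure (condLaw P G Z X ω) := by
      unfold condLaw
      infer_instance
    have := Measure.isProbabilityMeasure_map (μ := condLaw P G Z X ω)
      (measurable_pi_apply i).aemeasurable
    simp [← h]
  · have hr := Real.sqrt_pos.2 h
    have hα0 := (hY.alpha_pos i).ne'
    have hlaw : IsStdCTS (α i) (lp i * √V) (lm i * √V) ((condLaw P G Z X ω).map fun x => x i) :=
      hlaw h
    rw [hlaw.charFun_eq hα0 (hα i) (hY.alpha_le_two i) (mul_pos (hY.lp_pos i) hr)
      (mul_pos (hY.lm_pos i) hr), mul_comm,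
      stdCTSExponent_mul hα0 (hα i) (hY.lp_pos i) (hY.lm_pos i) hr, ← ofReal_pow, Real.sq_sqrt hV]

theorem ae_charFun_condLaw_map_mixedTSMap (hY : IsMultivariateMixedTS P μ β a α lp lm G Z X Y)
    (hα : ∀ h, α h ≠ 1) (u : EuclideanSpace ℝ (Fin N)) :
    ∀ᵐ ω ∂P, charFun
        ((condLaw P G Z X ω).map fun x => mixedTSMap μ β a (mixingPair G Z ω, x)) u
      = exp (I * ∑ h, (u h : ℂ) * μ h)
        * exp (∑ h, mixedTSExponent (u h) (β h) (lp h) (lm h) (α h)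
          * mixingVar a (mixingPair G Z ω) h) := by
  filter_upwards [hY.cond_indep,
    ae_all_iff.2 fun i => hY.ae_charFun_condLaw_map_eval hα (u i) i] with ω hindep hchar
  change iIndepFun _ (condLaw P G Z X ω) at hindep
  have := hindep.isProbabilityMeasure
  simp only [mixedTSMap]
  rw [charFun_map_toLp_add_mul hindep fun i => (measurable_pi_apply i).aemeasurable]
  simp only [hchar]
  rw [← exp_sum, ← exp_add, ← exp_add, Finset.mul_sum, Finset.mul_sum, ← Finset.sum_add_distrib,
    ← Finset.sum_add_distrib]
  refine congrArg exp (Finset.sum_congr rfl fun i _ => ?_)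
  rw [mixedTSExponent]
  push_cast
  ring

theorem charFun_eq_integral (hY : IsMultivariateMixedTS P μ β a α lp lm G Z X Y)
    (hα : ∀ h, α h ≠ 1) (u : EuclideanSpace ℝ (Fin N)) :
    charFun (P.map Y) u = exp (I * ∑ h, (u h : ℂ) * μ h)
      * ∫ ω, exp (∑ h, mixedTSExponent (u h) (β h) (lp h) (lm h) (α h)
          * mixingVar a (mixingPair G Z ω) h) ∂P := by
  rw [Measure.map_congr hY.ae_eq_mixedTSMap, charFun_map_prodMk_eq_integral_condDistrib
      hY.measurable_mixingPair (measurable_pi_lambda _ hY.measurable_X).aemeasurable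
      (measurable_mixedTSMap μ β a), ← integral_const_mul]
  exact integral_congr_ae (hY.ae_charFun_condLaw_map_mixedTSMap hα u)

theorem integral_cexp_sum_mul_mixingVar (hY : IsMultivariateMixedTS P μ β a α lp lm G Z X Y)
    (z : Fin N → ℂ) :
    ∫ ω, exp (∑ h, z h * mixingVar a (mixingPair G Z ω) h) ∂P
      = complexMGF Z P (∑ h, a h * z h) * ∏ h, complexMGF (G h) P (z h) := by
  have hfactor := integral_cexp_sum_mul_eq_prod_complexMGF hY.indep
    (fun | none => hY.measurable_Z.aemeasurable | some i => (hY.measurable_G i).aemeasurable)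
    (fun j => j.elim (∑ h, a h * z h) z)
  simp only [Fintype.sum_option, Fintype.prod_option, Option.elim] at hfactor
  rw [← hfactor]
  congr with ω
  rw [Finset.sum_mul, ← Finset.sum_add_distrib]
  refine congrArg exp (Finset.sum_congr rfl fun i _ => ?_)
  simp only [mixingVar, mixingPair]
  push_cast
  ring

theorem charFun_eq_prod_complexMGF (hY : IsMultivariateMixedTS P μ β a α lp lm G Z X Y)
    (hα : ∀ h, α h ≠ 1) (u : EuclideanSpace ℝ (Fin N)) :
    charFun (P.map Y) u = exp (I * ∑ h, (u h : ℂ) * μ h)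
      * complexMGF Z P (∑ h, a h * mixedTSExponent (u h) (β h) (lp h) (lm h) (α h))
      * ∏ h, complexMGF (G h) P (mixedTSExponent (u h) (β h) (lp h) (lm h) (α h)) := by
  rw [hY.charFun_eq_integral hα, hY.integral_cexp_sum_mul_mixingVar, mul_assoc]

theorem mixedTSExponent_re_nonpos (hY : IsMultivariateMixedTS P μ β a α lp lm G Z X Y)
    (hα : ∀ h, α h ≠ 1) (u : ℝ) (h : Fin N) :
    (mixedTSExponent u (β h) (lp h) (lm h) (α h)).re ≤ 0 := by
  simpa [mixedTSExponent] using stdCTSExponent_re_nonpos (hY.alpha_pos h).ne' (hα h)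
    (hY.alpha_le_two h) (hY.lp_pos h) (hY.lm_pos h) u

theorem sum_mul_mixedTSExponent_re_nonpos (hY : IsMultivariateMixedTS P μ β a α lp lm G Z X Y)
    (hα : ∀ h, α h ≠ 1) (u : Fin N → ℝ) :
    (∑ h, a h * mixedTSExponent (u h) (β h) (lp h) (lm h) (α h)).re ≤ 0 := by
  rw [re_sum]
  refine Finset.sum_nonpos fun h _ => ?_
  rw [re_ofReal_mul]
  exact mul_nonpos_of_nonneg_of_nonpos (hY.a_nonneg h) (hY.mixedTSExponent_re_nonpos hα (u h) h)

end IsMultivariateMixedTS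

end MixedTS

theorem mainTheorem4 {Ω : Type*} [MeasurableSpace Ω] (P : Measure Ω) [IsProbabilityMeasure P]
    {N : ℕ} (μ β a α lp lm : Fin N → ℝ) (G : Fin N → Ω → ℝ) (Z : Ω → ℝ) (X : Fin N → Ω → ℝ)
    (Y : Ω → EuclideanSpace ℝ (Fin N))
    (hY : IsMultivariateMixedTS P μ β a α lp lm G Z X Y)
    -- the closed form of the exponent has the factor `α - 1` in its denominators
    (hα : ∀ h, α h ≠ 1) :
    -- `L_stdCTS` is the characteristic exponent of the standardized CTS law
    (∀ (h : Fin N) (ρ : Measure ℝ), IsStdCTS (α h) (lp h) (lm h) ρ →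
      ∀ t : ℝ, charFun ρ t = Complex.exp (stdCTSExponent t (lp h) (lm h) (α h))) ∧
    ∀ u : EuclideanSpace ℝ (Fin N),
      -- the cumulant functions are well defined at the points where they are evaluated
      (Integrable (fun ω => Complex.exp
          ((∑ h, (Complex.I * a h * u h * β h
            + a h * stdCTSExponent (u h) (lp h) (lm h) (α h))) * Z ω)) P ∧
        complexMGF Z P (∑ h, (Complex.I * a h * u h * β h
            + a h * stdCTSExponent (u h) (lp h) (lm h) (α h))) ≠ 0) ∧
      (∀ h, Integrable (fun ω => Complex.exp
          ((Complex.I * u h * β h + stdCTSExponent (u h) (lp h) (lm h) (α h)) * G h ω)) P ∧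
        complexMGF (G h) P
          (Complex.I * u h * β h + stdCTSExponent (u h) (lp h) (lm h) (α h)) ≠ 0) ∧
      -- the characteristic function
      charFun (P.map Y) u =
        Complex.exp (Complex.I * ∑ h, (u h : ℂ) * μ h)
        * Complex.exp (logMGF P Z (∑ h, (Complex.I * a h * u h * β h
            + a h * stdCTSExponent (u h) (lp h) (lm h) (α h))))
        * ∏ h, Complex.exp (logMGF P (G h)
            (Complex.I * u h * β h + stdCTSExponent (u h) (lp h) (lm h) (α h))) := by
  refine ⟨fun h ρ hρ t => hρ.charFun_eq (hY.alpha_pos h).ne' (hα h) (hY.alpha_le_two h)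
    (hY.lp_pos h) (hY.lm_pos h) t, fun u => ?_⟩
  have hpoint : ∑ h, (Complex.I * a h * u h * β h
        + a h * stdCTSExponent (u h) (lp h) (lm h) (α h))
      = ∑ h, a h * mixedTSExponent (u h) (β h) (lp h) (lm h) (α h) :=
    Finset.sum_congr rfl fun h _ => by
      rw [mixedTSExponent]
      ring
  have hZ_re := hY.sum_mul_mixedTSExponent_re_nonpos hα u
  have hG_re (h : Fin N) := hY.mixedTSExponent_re_nonpos hα (u h) h
  have hZ_ae := hY.measurable_Z.aemeasurable (μ := P)
  have hG_ae (h : Fin N) := (hY.measurable_G h).aemeasurable (μ := P)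
  have hZ_ne := hY.Z_infDiv.complexMGF_ne_zero hZ_ae hY.Z_nonneg hZ_re
  have hG_ne (h : Fin N) :=
    (hY.G_infDiv h).complexMGF_ne_zero (hG_ae h) (hY.G_nonneg h) (hG_re h)
  rw [hpoint]
  refine ⟨⟨integrable_cexp_mul_of_re_nonpos hZ_ae hY.Z_nonneg hZ_re, hZ_ne⟩, fun h =>
    ⟨integrable_cexp_mul_of_re_nonpos (hG_ae h) (hY.G_nonneg h) (hG_re h), hG_ne h⟩, ?_⟩
  rw [hY.charFun_eq_prod_complexMGF hα u, logMGF, Complex.exp_log hZ_ne]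
  exact congrArg _ (Finset.prod_congr rfl fun h _ => (Complex.exp_log (hG_ne h)).symm)
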